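/- Let $G$ be a group, $\{H_\lambda\}_{\lambda\in\Lambda}$ a (possibly infinite) collection of subgroups of $G$, and $X\subseteq G$ a symmetric subset ($X=X^{-1}$), not necessarily finite. We say that $X$ generates $G$ relative to $\{H_\lambda\}$ if $G=\langle X\cup\bigcup_\lambda H_\lambda\rangle$; relative generating sets are always assumed symmetric. **Hyperbolic embedding.** Let $\mathcal H=\bigsqcup_{\lambda} H_\lambda$, and let $\Gamma(G,X\sqcup\mathcal H)$ be the Cayley graph with vertex set $G$ having, for every $g\in G$ and every letter $a\in X\sqcup\mathcal H$ (disjoint unions), an edge labelled $a$ from $g$ to $ga$. For $h,k\in H_\lambda$ let $\widehat d_\lambda(h,k)\in[0,\infty]$ be the length of a shortest path from $h$ to $k$ in the graph obtained from $\Gamma(G,X\sqcup\mathcal H)$ by deleting all edges that join two elements of $H_\lambda$ and are labelled by letters of $H_\lambda$ ($\infty$ if there is no such path). One writes $\{H_\lambda\}\hookrightarrow_h(G,X)$ if (a) $X$ generates $G$ relative to $\{H_\lambda\}$ and $\Gamma(G,X\sqcup\mathcal H)$ is hyperbolic, i.e. for some $\delta\ge 0$ every side of every geodesic triangle lies in the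 $\delta$-neighbourhood of the union of the other two sides; and (b) for every $\lambda$, every ball of finite radius in $(H_\lambda,\widehat d_\lambda)$ is finite. A group $G$ is hyperbolic relative to a finite collection of subgroups $\{H_1,\dots,H_n\}$ (called peripheral subgroups) if $\{H_1,\dots,H_n\}\hookrightarrow_h(G,Y)$ for some finite symmetric $Y\subseteq G$. **Incompressibility.** For a group $K$ let $\mathcal M(K)$ be the set of left invariant metrics on $K$ with values in $\mathbb N\cup\{0\}$. Let $X$ generate $G$ relative to $\{H_\lambda\}$ and let $C=\{d_{H_\lambda}\}_{\lambda\in\Lambda}$ with $d_{H_\lambda}\in\mathcal M(H_\lambda)$. Put $w_{C,X}(1)=0$; $w_{C,X}(g)=1$ for $g\in X\setminus\{1\}$; $w_{C,X}(g)=\min\{d_{H_\lambda}(1,g)\mid g\in H_\lambda\}$ for $g\neq 1$, $g\in\bigcup_\lambda H_\lambda\setminus X$; and $w_{C,X}(g)=\infty$ otherwise. The metric on $G$ induced by $C$ is $$d_{C,X}(f,g)=\min\Big\{\sum_{i=1}^k w_{C,X}(x_i)\;\Big|\;k\ge 0,\ x_1,\dots,x_k\in G,\ x_1\cdots x_k=f^{-1}g\Big\}.$$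 The collection $\{H_\lambda\}$ is incompressible in $G$ with respect to $X$ if for every such $C$ and every $\lambda\in\Lambda$ the inclusion $(H_\lambda,d_{H_\lambda})\to(G,d_{C,X})$ is a quasi-isometric embedding, i.e. there is a constant $K>0$ with $\frac1K d_{H_\lambda}(h,k)-K\le d_{C,X}(h,k)\le K d_{H_\lambda}(h,k)+K$ for all $h,k\in H_\lambda$. The collection is incompressible in $G$ if it is incompressible in $G$ with respect to some finite set $X$ generating $G$ relative to $\{H_\lambda\}$. **Corollary.** If $\{H_\lambda\}_{\lambda\in\Lambda}\hookrightarrow_h(G,X)$, then $\{H_\lambda\}_{\lambda\in\Lambda}$ is incompressible in $G$ with respect to $X$. In particular, if $G$ is finitely generated and hyperbolic relative to a collection of subgroups $\{H_1,\dots,H_n\}$, then $\{H_1,\dots,H_n\}$ is incompressible in $G$. -/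

import Mathlib

open scoped ENNReal NNReal

universe u v

noncomputable section

/-! ## Multigraphs as (extended) metric spaces -/

/-- A multigraph with vertex set `V` and edge set `E`; loops and multiple edges are allowed. The
chosen orientation of the edges plays no role for the metric. -/
structure MetricGraph (V E : Type*) where
  src : E → V
  tgt : E → V

namespace MetricGraph

variable {V E : Type*} (M : MetricGraph V E)

/-- The simple graph recording which distinct vertices are joined by at least one edge. -/
def adjGraph : SimpleGraph V :=
  SimpleGraph.fromRel fun u v => ∃ e, M.src e = u ∧ M.tgt e = v

/-- The length of a shortest (unoriented) edge path between two vertices, `⊤` if there is none. -/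
def vdist (u v : V) : ℕ∞ := M.adjGraph.edist u v

/-- Points of the graph, before gluing: a vertex, or the point `(e, t)` of the closed edge `e` at
distance `t` from `src e` and `1 - t` from `tgt e`. -/
inductive PrePoint (M : MetricGraph V E) : Type _
  | vertex (v : V) : PrePoint M
  | onEdge (e : E) (t : unitInterval) : PrePoint M

variable {M}

/-- The distance, inside a closed edge containing the point, from the point to the vertex `u`
(`⊤` if `u` is not an endpoint of that edge). -/
def toEnd (p : M.PrePoint) (u : V) : ℝ≥0∞ :=
  open Classical in
  match p with
  | .vertex v => if v = u then 0 else ⊤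
  | .onEdge e t =>
      min (if M.src e = u then ENNReal.ofReal t else ⊤)
        (if M.tgt e = u then ENNReal.ofReal (1 - t) else ⊤)

/-- The distance between two points of the same edge measured along that edge, `⊤` for points that
are not given on the same edge. -/
def alongEdge (p q : M.PrePoint) : ℝ≥0∞ :=
  open Classical in
  match p, q with
  | .onEdge e s, .onEdge f t => if e = f then ENNReal.ofReal |(s : ℝ) - t| else ⊤
  | _, _ => ⊤

/-- The combinatorial path metric of the graph (edges have length one): a shortest path either stays
inside an edge, or leaves through an end `u` of the first edge, follows edges to a vertex `v`, and
enters the last edge through its end `v`. -/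
def preDist (p q : M.PrePoint) : ℝ≥0∞ :=
  min (alongEdge p q) (⨅ (u : V) (v : V), toEnd p u + (M.vdist u v : ℝ≥0∞) + toEnd q v)

theorem alongEdge_comm (p q : M.PrePoint) : alongEdge p q = alongEdge q p := by
  rcases p with p | ⟨e, s⟩ <;> rcases q with q | ⟨f, t⟩ <;> simp only [alongEdge]
  by_cases h : e = f
  · simp [h, abs_sub_comm]
  · simp [h, Ne.symm h]

theorem alongEdge_triangle (p q r : M.PrePoint) :
    alongEdge p r ≤ alongEdge p q + alongEdge q r := by
  rcases p with p | ⟨e, s⟩ <;> rcases q with q | ⟨f, t⟩ <;> rcases r with r | ⟨g, x⟩ <;>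
    simp only [alongEdge, top_add, add_top, le_top]
  by_cases h : e = f
  · by_cases h' : f = g
    · subst h h'
      simp only [if_true]
      rw [← ENNReal.ofReal_add (abs_nonneg _) (abs_nonneg _)]
      exact ENNReal.ofReal_le_ofReal (abs_sub_le _ _ _)
    · simp [h']
  · simp [h]

theorem toEnd_le (p q : M.PrePoint) (u : V) : toEnd p u ≤ alongEdge p q + toEnd q u := by
  rcases p with p | ⟨e, s⟩ <;> rcases q with q | ⟨f, t⟩ <;>
    simp only [alongEdge, top_add, le_top]
  by_cases h : e = f
  · subst h
    simp only [toEnd, if_true]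
    rw [← min_add_add_left]
    apply min_le_min
    · split_ifs
      · rw [← ENNReal.ofReal_add (abs_nonneg _) t.2.1]
        apply ENNReal.ofReal_le_ofReal
        linarith [le_abs_self ((s : ℝ) - t)]
      · simp
    · split_ifs
      · rw [← ENNReal.ofReal_add (abs_nonneg _) (by linarith [t.2.2])]
        apply ENNReal.ofReal_le_ofReal
        linarith [neg_abs_le ((s : ℝ) - t)]
      · simp
  · simp [h]

theorem vdist_src_tgt (e : E) : M.vdist (M.src e) (M.tgt e) ≤ 1 := by
  by_cases h : M.src e = M.tgt e
  · rw [h]; simp [vdist]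
  · have : M.adjGraph.Adj (M.src e) (M.tgt e) := by
      simp only [adjGraph, SimpleGraph.fromRel_adj]
      exact ⟨h, Or.inl ⟨e, rfl, rfl⟩⟩
    simpa [vdist] using SimpleGraph.edist_le this.toWalk

theorem vdist_le_toEnd (p : M.PrePoint) (u v : V) :
    (M.vdist u v : ℝ≥0∞) ≤ toEnd p u + toEnd p v := by
  have hcomm : ∀ a b, M.vdist a b = M.vdist b a := fun a b => SimpleGraph.edist_comm
  have hself : ∀ a, M.vdist a a = 0 := fun a => SimpleGraph.edist_self
  rcases p with p | ⟨e, t⟩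
  · simp only [toEnd]
    split_ifs with h h' <;> simp
    rw [← h, ← h']; simp [hself]
  · have h1 : (1 : ℝ≥0∞) = ENNReal.ofReal t + ENNReal.ofReal (1 - t) := by
      rw [← ENNReal.ofReal_add t.2.1 (by linarith [t.2.2])]; simp
    have hle : (M.vdist (M.src e) (M.tgt e) : ℝ≥0∞) ≤ 1 := by
      have := vdist_src_tgt (M := M) e
      exact_mod_cast this
    simp only [toEnd]
    rw [← min_add_add_right, ← min_add_add_left, ← min_add_add_left]
    refine le_min (le_min ?_ ?_) (le_min ?_ ?_)
    · split_ifs with h h' <;> try simp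
      rw [← h, ← h']; simp [hself]
    · split_ifs with h h' <;> try simp
      rw [← h, ← h', ← h1]; exact hle
    · split_ifs with h h' <;> try simp
      rw [← h, ← h', hcomm, add_comm, ← h1]; exact hle
    · split_ifs with h h' <;> try simp
      rw [← h, ← h']; simp [hself]

instance : PseudoEMetricSpace M.PrePoint where
  edist := preDist
  edist_self p := by
    rcases p with p | ⟨e, t⟩
    · refine le_antisymm (min_le_of_right_le ?_) zero_le
      refine (iInf₂_le p p).trans ?_
      simp [toEnd, vdist]
    · refine le_antisymm (min_le_of_left_le ?_) zero_le
      simp [alongEdge]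
  edist_comm p q := by
    simp only [preDist]
    rw [alongEdge_comm, iInf_comm]
    congr 1
    refine iInf_congr fun u => iInf_congr fun v => ?_
    rw [show M.vdist v u = M.vdist u v from SimpleGraph.edist_comm]
    ring
  edist_triangle p q r := by
    have key : ∀ a b c : V, (M.vdist a c : ℝ≥0∞) ≤ M.vdist a b + M.vdist b c := by
      intro a b c
      have : M.vdist a c ≤ M.vdist a b + M.vdist b c := SimpleGraph.edist_triangle
      exact_mod_cast this
    have hpath : ∀ {x y : M.PrePoint} (u v : V),
        preDist x y ≤ toEnd x u + (M.vdist u v : ℝ≥0∞) + toEnd y v :=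
      fun {x y} u v => min_le_of_right_le
        (iInf₂_le (f := fun u v => toEnd x u + (M.vdist u v : ℝ≥0∞) + toEnd y v) u v)
    change preDist p r ≤ preDist p q + preDist q r
    conv_rhs => simp only [preDist]
    rw [← min_add_add_right, ← min_add_add_left, ← min_add_add_left]
    refine le_min (le_min ?_ ?_) (le_min ?_ ?_)
    · exact (min_le_left _ _).trans (alongEdge_triangle p q r)
    · simp only [ENNReal.add_iInf]
      refine le_iInf₂ fun u v => (hpath u v).trans ?_
      rw [← add_assoc, ← add_assoc]
      gcongr
      exact toEnd_le p q u
    · simp only [ENNReal.iInf_add]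
      refine le_iInf₂ fun u v => (hpath u v).trans ?_
      rw [add_assoc _ (toEnd q v)]
      gcongr
      rw [alongEdge_comm q r, add_comm (toEnd q v)]
      exact toEnd_le r q v
    · simp only [ENNReal.iInf_add, ENNReal.add_iInf]
      refine le_iInf₂ fun u v => le_iInf₂ fun u' v' => ?_
      refine (hpath u' v).trans ?_
      calc toEnd p u' + (M.vdist u' v : ℝ≥0∞) + toEnd r v
          ≤ toEnd p u' + (M.vdist u' v' + (toEnd q v' + toEnd q u) + M.vdist u v) + toEnd r v := by
            gcongr
            refine (key u' u v).trans ?_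
            gcongr
            refine (key u' v' u).trans ?_
            gcongr
            exact vdist_le_toEnd q v' u
        _ = _ := by ring

variable (M) in
/-- The graph as an extended metric space (its geometric realization): points at distance zero, such
as `(e, 0)` and `src e`, are identified. The metric is `MetricGraph.preDist` by
`SeparationQuotient.edist_mk`. -/
abbrev Realization : Type _ := SeparationQuotient M.PrePoint

end MetricGraph

/-! ## Hyperbolic spaces -/

/-- `γ`, restricted to `[0, L]`, is a geodesic from `x` to `y`. -/
structure IsGeodesicFromTo {S : Type*} [EMetricSpace S] (γ : ℝ → S) (L : ℝ) (x y : S) : Prop where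
  nonneg : 0 ≤ L
  source : γ 0 = x
  target : γ L = y
  isometry : ∀ s ∈ Set.Icc 0 L, ∀ t ∈ Set.Icc 0 L, edist (γ s) (γ t) = ENNReal.ofReal |s - t|

/-- Hyperbolicity for geodesic spaces: there is `δ ≥ 0` such that every side of every geodesic
triangle lies in the (closed) `δ`-neighbourhood of the union of the other two sides. The side `α`
is arbitrary, as the vertices may be permuted cyclically. -/
def IsRipsHyperbolic (S : Type*) [EMetricSpace S] : Prop :=
  ∃ δ : ℝ≥0, ∀ (x y z : S) (α β γ : ℝ → S) (a b c : ℝ),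
    IsGeodesicFromTo α a x y → IsGeodesicFromTo β b y z → IsGeodesicFromTo γ c z x →
    ∀ p ∈ α '' Set.Icc 0 a, ∃ q ∈ β '' Set.Icc 0 b ∪ γ '' Set.Icc 0 c, edist p q ≤ δ

/-! ## Hyperbolically embedded collections of subgroups -/

section HyperbolicallyEmbedded

variable {G : Type*} [Group G] {Λ : Type*} (H : Λ → Subgroup G) (X : Set G)

/-- `X` generates `G` relative to the collection `H`; generating sets are symmetric. -/
structure IsRelGeneratingSet : Prop where
  symm : ∀ x ∈ X, x⁻¹ ∈ X
  closure_eq_top : Subgroup.closure (X ∪ ⋃ i, (H i : Set G)) = ⊤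

/-- The alphabet `X ⊔ 𝓗`, where `𝓗` is the disjoint union of the subgroups `H i`. -/
abbrev RelAlphabet : Type _ := X ⊕ (Σ i, H i)

variable {H X} in
/-- The element of `G` represented by a letter. -/
def RelAlphabet.val : RelAlphabet H X → G
  | Sum.inl x => x
  | Sum.inr ⟨_, h⟩ => h

/-- The Cayley graph `Γ(G, X ⊔ 𝓗)`: for each vertex `g` and each letter `a` there is an edge labelled
`a` from `g` to `g * a`. -/
def relCayleyGraph : MetricGraph G (G × RelAlphabet H X) where
  src e := e.1
  tgt e := e.1 * e.2.val

/-- The edges of the subgraph `Γ(H i, H i)` of `Γ(G, X ⊔ 𝓗)`. -/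
def IsSubgroupEdge (i : Λ) (e : G × RelAlphabet H X) : Prop :=
  e.1 ∈ H i ∧ ∃ h : H i, e.2 = Sum.inr ⟨i, h⟩

/-- The graph `Δ i` obtained from `Γ(G, X ⊔ 𝓗)` by removing all edges of `Γ(H i, H i)`. -/
def deltaGraph (i : Λ) : MetricGraph G {e : G × RelAlphabet H X // ¬ IsSubgroupEdge H X i e} where
  src e := (relCayleyGraph H X).src e.1
  tgt e := (relCayleyGraph H X).tgt e.1

/-- The extended metric on `H i`: the length of a shortest path in `Δ i`. -/
def subgroupDist (i : Λ) (h k : H i) : ℕ∞ := (deltaGraph H X i).vdist (h : G) (k : G)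

/-- `{H i} ↪ₕ (G, X)`. The Cayley graph is connected by `gen`, hence a geodesic space. -/
structure IsHypEmbedded : Prop where
  gen : IsRelGeneratingSet H X
  hyperbolic : IsRipsHyperbolic (relCayleyGraph H X).Realization
  proper : ∀ (i : Λ) (h : H i) (n : ℕ), {k : H i | subgroupDist H X i h k ≤ n}.Finite

/-- `G` is hyperbolic relative to the finite collection `H`. -/
def IsRelativelyHyperbolic [Finite Λ] : Prop :=
  ∃ Y : Set G, Y.Finite ∧ IsHypEmbedded H Y

end HyperbolicallyEmbedded

/-! ## Induced metrics and incompressible collections -/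

/-- The set `𝓜(K)` of left invariant metrics on a group `K` with values in `ℕ ∪ {0}`. -/
structure IntLeftInvMetric (K : Type*) [Group K] where
  d : K → K → ℕ
  d_eq_zero_iff : ∀ f g, d f g = 0 ↔ f = g
  d_comm : ∀ f g, d f g = d g f
  d_triangle : ∀ f g h, d f h ≤ d f g + d g h
  d_mul_left : ∀ f g h, d (f * g) (f * h) = d g h

section Incompressible

variable {G : Type*} [Group G] {Λ : Type*} (H : Λ → Subgroup G) (X : Set G)

/-- The distance associated to a weight function `w`: the least total weight of a decomposition of
`f⁻¹ * g` into a finite product. -/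
def weightDist (w : G → ℕ∞) (f g : G) : ℕ∞ :=
  ⨅ (l : List G) (_ : l.prod = f⁻¹ * g), (l.map w).sum

variable {H} in
open Classical in
/-- The weight function `w_{C,X}`. The infimum over the empty set is `⊤`. -/
def inducedWeight (C : ∀ i, IntLeftInvMetric (H i)) (g : G) : ℕ∞ :=
  if g = 1 then 0
  else if g ∈ X then 1
  else ⨅ (i : Λ) (hg : g ∈ H i), ((C i).d 1 ⟨g, hg⟩ : ℕ∞)

variable {H} in
/-- The metric `d_{C,X}` on `G` induced by the collection `C` of metrics. -/
def inducedDist (C : ∀ i, IntLeftInvMetric (H i)) : G → G → ℕ∞ :=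
  weightDist (inducedWeight X C)

/-- Quasi-isometric embeddings with respect to extended distance functions:
`dR x y / K - K ≤ dS (f x) (f y) ≤ K * dR x y + K`. -/
def IsQuasiIsometricEmbedding {R S : Type*} (dR : R → R → ℕ∞) (dS : S → S → ℕ∞) (f : R → S) :
    Prop :=
  ∃ K : ℝ≥0, 0 < K ∧ ∀ x y : R,
    (dR x y : ℝ≥0∞) / K ≤ (dS (f x) (f y) : ℝ≥0∞) + K ∧
    (dS (f x) (f y) : ℝ≥0∞) ≤ K * (dR x y : ℝ≥0∞) + K

/-- The collection `H` is incompressible in `G` with respect to `X`. -/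
def IsIncompressibleWrt : Prop :=
  IsRelGeneratingSet H X ∧
  ∀ (C : ∀ i, IntLeftInvMetric (H i)) (i : Λ),
    IsQuasiIsometricEmbedding (fun h k : H i => ((C i).d h k : ℕ∞)) (inducedDist X C)
      (fun h : H i => (h : G))

/-- The collection `H` is incompressible in `G`: it is so with respect to some finite relative
generating set. -/
def IsIncompressible : Prop :=
  ∃ Y : Set G, Y.Finite ∧ IsIncompressibleWrt H Y

end Incompressible

end

/-! Fix `i`. In the Cayley graph the subgroup `H i` has diameter at most one, so thin triangles make
nearest-point projection `π` onto it coarsely Lipschitz. The stronger fact needed is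
`IsNearest.edist_le_of_edist_le_one`: projections of the ends of an edge stay boundedly close even
for the relative metric, in which edges inside `H i` are forbidden, provided the ends of that edge
are themselves joined by an edge of `Δ i`. The paths that witness this follow geodesics that meet `H
i` at most at their endpoints.

By left invariance and finiteness of balls, such a bound also bounds any left invariant integer
metric on `H i` (`exists_dist_le`). A letter joining vertices not adjacent in `Δ i` lies in `H i`
alone, and both vertices lie in `H i`, where `π` is the identity, so the displacement equals the
weight of the letter. Hence `π` expands weights by at most a constant factor (`exists_retraction`),
and summing along a decomposition of `h⁻¹ * k` gives the lower bound. The upper bound comes from the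
one-letter decomposition.

Hyperbolicity concerns the geometric realization; `exists_hasThinTriangles` transfers it to
vertices. -/

noncomputable section

/-! ## Betweenness and thin triangles in simple graphs -/

namespace SimpleGraph

variable {V : Type*} {A B : SimpleGraph V}

/-- The vertex `u` lies on a geodesic from `x` to `y`. -/
def IsBtw (A : SimpleGraph V) (x u y : V) : Prop :=
  A.dist x u + A.dist u y = A.dist x y

/-- Every vertex on a side of a geodesic triangle is `D`-close to one of the other two sides. -/
def HasThinTriangles (A : SimpleGraph V) (D : ℕ) : Prop :=
  ∀ x y z u, A.IsBtw x u y → ∃ v, (A.IsBtw y v z ∨ A.IsBtw z v x) ∧ A.dist u v ≤ D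

theorem IsBtw.symm {x u y : V} (h : A.IsBtw x u y) : A.IsBtw y u x := by
  unfold IsBtw at *
  rw [A.dist_comm (u := y), A.dist_comm (u := u) (v := x), A.dist_comm (u := y) (v := x)]
  omega

theorem Walk.isBtw_of_mem_support (hA : A.Connected) {x y u : V} (p : A.Walk x y)
    (hp : p.length = A.dist x y) (hu : u ∈ p.support) : A.IsBtw x u y := by
  obtain ⟨q, r, rfl⟩ := p.mem_support_iff_exists_append.mp hu
  rw [Walk.length_append] at hp
  have h₁ := A.dist_le q
  have h₂ := A.dist_le r
  have h₃ := hA.dist_triangle (u := x) (v := u) (w := y)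
  unfold IsBtw
  omega

theorem exists_walk_through_of_isBtw (hA : A.Connected) {x y u : V} (h : A.IsBtw x u y) :
    ∃ p : A.Walk x y, p.length = A.dist x y ∧ u ∈ p.support := by
  obtain ⟨q, hq⟩ := hA.exists_walk_length_eq_dist x u
  obtain ⟨r, hr⟩ := hA.exists_walk_length_eq_dist u y
  refine ⟨q.append r, ?_, ?_⟩
  · rw [Walk.length_append, hq, hr, h]
  · exact (Walk.mem_support_append_iff q r).2 (Or.inl q.end_mem_support)

theorem exists_isBtw_dist_eq (hA : A.Connected) {x y : V} {n : ℕ} (hn : n ≤ A.dist x y) :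
    ∃ u, A.IsBtw x u y ∧ A.dist u y = n := by
  obtain ⟨p, hp⟩ := hA.exists_walk_length_eq_dist x y
  refine ⟨p.getVert (p.length - n), p.isBtw_of_mem_support hA hp (p.getVert_mem_support _), ?_⟩
  have h₁ := A.dist_le (p.take (p.length - n))
  have h₂ := A.dist_le (p.drop (p.length - n))
  have h₃ := p.isBtw_of_mem_support hA hp (p.getVert_mem_support (p.length - n))
  rw [Walk.take_length] at h₁
  rw [Walk.drop_length] at h₂
  unfold IsBtw at h₃
  omega

/-! ## Nearest points -/

/-- The vertex `x` is a point of `S` nearest to `v`. -/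
def IsNearest (A : SimpleGraph V) (S : Set V) (v x : V) : Prop :=
  x ∈ S ∧ ∀ s ∈ S, A.dist v x ≤ A.dist v s

theorem exists_isNearest {S : Set V} (hS : S.Nonempty) (v : V) : ∃ x, A.IsNearest S v x :=
  exists_minimalFor_of_wellFoundedLT (· ∈ S) (A.dist v) hS |>.imp fun _ hx =>
    ⟨hx.1, fun _ hs => (le_total _ _).elim id fun h => hx.2 hs h⟩

theorem IsNearest.eq_of_mem {S : Set V} (hA : A.Connected) {v x : V} (h : A.IsNearest S v x)
    (hv : v ∈ S) : x = v := by
  have := h.2 v hv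
  rw [dist_self, Nat.le_zero, hA.dist_eq_zero_iff] at this
  exact this.symm

theorem IsNearest.of_isBtw {S : Set V} (hA : A.Connected) {v u x : V} (h : A.IsNearest S v x)
    (hu : A.IsBtw v u x) : A.IsNearest S u x := by
  refine ⟨h.1, fun s hs => ?_⟩
  have h₁ := h.2 s hs
  have h₂ := hA.dist_triangle (u := v) (v := u) (w := s)
  unfold IsBtw at hu
  omega

/-- A walk meeting `S` at most at its end survives the deletion of the edges inside `S`. -/
theorem Walk.edist_le_length_of_avoids {S : Set V}
    (hB : ∀ u v, A.Adj u v → ¬(u ∈ S ∧ v ∈ S) → B.Adj u v) {x y : V} (p : A.Walk x y)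
    (hp : ∀ z ∈ p.support, z ∈ S → z = y) : B.edist x y ≤ p.length := by
  induction p with
  | nil => simp
  | @cons x w y h p ih =>
    have hxw : B.Adj x w := by
      refine hB _ _ h fun ⟨hx, hw⟩ => h.ne ?_
      rw [hp x (by simp) hx, hp w (by simp) hw]
    refine (B.edist_triangle (v := w)).trans ?_
    rw [edist_eq_one_iff_adj.2 hxw, Walk.length_cons, Nat.cast_add, Nat.cast_one, add_comm]
    gcongr
    exact ih fun z hz => hp z (by simp [hz])

/-- A vertex of `S` on a geodesic to a nearest point is no closer than that point, hence equals it.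
Distances in `B` are extended, as `B` may be disconnected. -/
theorem IsNearest.edist_le {S : Set V} (hA : A.Connected)
    (hB : ∀ u v, A.Adj u v → ¬(u ∈ S ∧ v ∈ S) → B.Adj u v) {v x : V} (h : A.IsNearest S v x) :
    B.edist v x ≤ A.dist v x := by
  obtain ⟨p, hp⟩ := hA.exists_walk_length_eq_dist v x
  rw [← hp]
  refine p.edist_le_length_of_avoids hB fun z hz hzS => ?_
  have h₁ := p.isBtw_of_mem_support hA hp hz
  have h₂ := h.2 z hzS
  unfold IsBtw at h₁
  exact hA.dist_eq_zero_iff.1 (by omega)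

theorem edist_le_of_dist_lt {S : Set V} (hA : A.Connected)
    (hB : ∀ u v, A.Adj u v → ¬(u ∈ S ∧ v ∈ S) → B.Adj u v) {v w : V}
    (h : ∀ s ∈ S, A.dist v w < A.dist v s) : B.edist v w ≤ A.dist v w := by
  obtain ⟨p, hp⟩ := hA.exists_walk_length_eq_dist v w
  rw [← hp]
  refine p.edist_le_length_of_avoids hB fun z hz hzS => ?_
  have h₁ := p.isBtw_of_mem_support hA hp hz
  have h₂ := h z hzS
  unfold IsBtw at h₁
  omega

/-- The nearest point projection to a set `S` of diameter at most one is coarsely Lipschitz, even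
when distances in `S` are measured without using the edges inside `S`. -/
theorem IsNearest.edist_le_of_edist_le_one {S : Set V} {D : ℕ} (hA : A.Connected)
    (hD : A.HasThinTriangles D) (hB : ∀ u v, A.Adj u v → ¬(u ∈ S ∧ v ∈ S) → B.Adj u v)
    (hS : ∀ s ∈ S, ∀ t ∈ S, A.dist s t ≤ 1) {v w x y : V} (hx : A.IsNearest S v x)
    (hy : A.IsNearest S w y) (hvw : A.dist v w ≤ 1) (hvwB : B.edist v w ≤ 1) :
    B.edist x y ≤ (8 * D + 8 : ℕ) := by
  have tri := fun a b c => hA.dist_triangle (u := a) (v := b) (w := c)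
  have comm := fun a b => A.dist_comm (u := a) (v := b)
  have hxy := hS x hx.1 y hy.1
  -- Near `S`, the route `x, v, w, y` is short enough. Beyond the threshold, a point `2 * D + 2`
  -- away from `x` is still at least `2 * D + 2` away from `v`.
  by_cases hclose : A.dist v x ≤ 4 * D + 3
  · have h₁ : A.dist w y ≤ 4 * D + 4 := by
      have h₂ := hy.2 x hx.1
      have h₃ := tri w v x
      have h₄ := comm w v
      omega
    calc B.edist x y ≤ B.edist x v + (B.edist v w + B.edist w y) :=
          (B.edist_triangle (v := v)).trans (by gcongr; exact B.edist_triangle)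
      _ ≤ ((4 * D + 3 : ℕ) : ℕ∞) + (((1 : ℕ) : ℕ∞) + ((4 * D + 4 : ℕ) : ℕ∞)) := by
          gcongr
          · rw [B.edist_comm]
            exact (hx.edist_le hA hB).trans (by exact_mod_cast hclose)
          · exact_mod_cast hvwB
          · exact (hy.edist_le hA hB).trans (by exact_mod_cast h₁)
      _ = (8 * D + 8 : ℕ) := by
          norm_cast
          omega
  · obtain ⟨x', hx'b, hx'⟩ := exists_isBtw_dist_eq hA (x := v) (y := x) (n := 2 * D + 2)
      (by omega)
    have hx'n := hx.of_isBtw hA hx'b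
    have hx'v : A.dist v x' + A.dist x' x = A.dist v x := hx'b
    -- Thinness of `v, x, y` and then of `v, y, w` moves `x'` to the side from `w` to `y`. The sides
    -- from `x` to `y` and from `w` to `v` have length at most one and are too far from `x'`.
    obtain ⟨y', hy'b, hx'y'⟩ : ∃ y', A.IsBtw w y' y ∧ A.dist x' y' ≤ 2 * D := by
      obtain ⟨z, hz | hz, hzd⟩ := hD v x y x' hx'b
      · have h₁ := tri x' z x
        have h₂ := comm x z
        unfold IsBtw at hz
        omega
      · obtain ⟨z', hz' | hz', hzd'⟩ := hD v y w z hz.symm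
        · refine ⟨z', hz'.symm, ?_⟩
          have := tri x' z z'
          omega
        · have h₁ := tri x' z z'
          have h₂ := tri x' z' v
          have h₃ := comm v x'
          have h₄ := comm w v
          unfold IsBtw at hz'
          omega
    -- `S` is at distance `2 * D + 2` from `x'`, so a geodesic of length at most `2 * D` misses it.
    have hfar : ∀ s ∈ S, A.dist x' y' < A.dist x' s := fun s hs => by
      have := hx'n.2 s hs
      omega
    have hy'n := hy.of_isBtw hA hy'b
    have hy'y : A.dist y' y ≤ 4 * D + 2 := by
      have h₁ := hy'n.2 x hx.1
      have h₂ := tri y' x' x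
      have h₃ := comm y' x'
      omega
    calc B.edist x y ≤ B.edist x x' + (B.edist x' y' + B.edist y' y) :=
          (B.edist_triangle (v := x')).trans (by gcongr; exact B.edist_triangle)
      _ ≤ ((2 * D + 2 : ℕ) : ℕ∞) + (((2 * D : ℕ) : ℕ∞) + ((4 * D + 2 : ℕ) : ℕ∞)) := by
          gcongr
          · rw [B.edist_comm]
            exact (hx'n.edist_le hA hB).trans (by exact_mod_cast hx'.le)
          · exact (edist_le_of_dist_lt hA hB hfar).trans (by exact_mod_cast hx'y')
          · exact (hy'n.edist_le hA hB).trans (by exact_mod_cast hy'y)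
      _ ≤ (8 * D + 8 : ℕ) := by
          norm_cast
          omega

end SimpleGraph

/-! ## Geodesics in the realization of a multigraph -/

namespace MetricGraph

variable {V E : Type*} {M : MetricGraph V E}

/-- The point of the realization given by a vertex. -/
def vpt (M : MetricGraph V E) (v : V) : M.Realization :=
  SeparationQuotient.mk (PrePoint.vertex v)

theorem edist_vpt (u v : V) : edist (M.vpt u) (M.vpt v) = (M.vdist u v : ℝ≥0∞) := by
  rw [vpt, vpt, SeparationQuotient.edist_mk]
  change min _ _ = _
  refine le_antisymm (min_le_of_right_le ((iInf₂_le u v).trans (by simp [toEnd]))) ?_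
  refine le_min (by simp [alongEdge]) (le_iInf₂ fun a b => ?_)
  simp only [toEnd]
  split_ifs with h₁ h₂ <;> simp
  rw [h₁, h₂]

theorem mk_eq_vpt_of_toEnd_eq_zero {p : M.PrePoint} {u : V} (h : toEnd p u = 0) :
    SeparationQuotient.mk p = M.vpt u := by
  rw [← edist_eq_zero, vpt, SeparationQuotient.edist_mk]
  refine le_antisymm (min_le_of_right_le ((iInf₂_le u u).trans ?_)) zero_le
  have h' : toEnd (M := M) (.vertex u) u = 0 := by simp [toEnd]
  simp [h, h', vdist]

theorem edist_onEdge_le (e : E) (s t : unitInterval) :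
    edist (SeparationQuotient.mk (PrePoint.onEdge e s) : M.Realization)
      (SeparationQuotient.mk (PrePoint.onEdge e t)) ≤ ENNReal.ofReal |(s : ℝ) - t| := by
  rw [SeparationQuotient.edist_mk]
  exact (min_le_left _ _).trans (by simp [alongEdge])

theorem exists_path_of_adj {u v : V} (h : M.adjGraph.Adj u v) :
    ∃ c : ℝ → M.Realization, c 0 = M.vpt u ∧ c 1 = M.vpt v ∧
      ∀ s ∈ Set.Icc (0 : ℝ) 1, ∀ t ∈ Set.Icc (0 : ℝ) 1,
        edist (c s) (c t) ≤ ENNReal.ofReal |s - t| := by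
  obtain ⟨-, ⟨e, rfl, rfl⟩ | ⟨e, rfl, rfl⟩⟩ := h
  · refine ⟨fun t => .mk (.onEdge e (Set.projIcc 0 1 zero_le_one t)), ?_, ?_, ?_⟩
    · exact mk_eq_vpt_of_toEnd_eq_zero (by simp [toEnd])
    · exact mk_eq_vpt_of_toEnd_eq_zero (by simp [toEnd])
    · intro s hs t ht
      refine (edist_onEdge_le e _ _).trans ?_
      rw [Set.projIcc_of_mem _ hs, Set.projIcc_of_mem _ ht]
  · refine ⟨fun t => .mk (.onEdge e (unitInterval.symm (Set.projIcc 0 1 zero_le_one t))),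
      ?_, ?_, ?_⟩
    · exact mk_eq_vpt_of_toEnd_eq_zero (by simp [toEnd])
    · exact mk_eq_vpt_of_toEnd_eq_zero (by simp [toEnd])
    · intro s hs t ht
      refine (edist_onEdge_le e _ _).trans ?_
      rw [Set.projIcc_of_mem _ hs, Set.projIcc_of_mem _ ht, unitInterval.coe_symm_eq,
        unitInterval.coe_symm_eq, sub_sub_sub_cancel_left, abs_sub_comm]

/-- Concatenation of edges preserves the 1-Lipschitz bound; for shortest walks this already forces
an isometry. -/
theorem exists_path_of_walk {u v : V} (p : M.adjGraph.Walk u v) :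
    ∃ γ : ℝ → M.Realization, (∀ n : ℕ, n ≤ p.length → γ n = M.vpt (p.getVert n)) ∧
      ∀ s ∈ Set.Icc (0 : ℝ) p.length, ∀ t ∈ Set.Icc (0 : ℝ) p.length,
        edist (γ s) (γ t) ≤ ENNReal.ofReal |s - t| := by
  induction p with
  | @nil u => exact ⟨fun _ => M.vpt u, by simp, by simp⟩
  | @cons u w v h p ih =>
    obtain ⟨γ, hγ, hl⟩ := ih
    obtain ⟨c, hc₀, hc₁, hc⟩ := exists_path_of_adj h
    have hγ₀ : γ 0 = M.vpt w := by simpa using hγ 0 (Nat.zero_le _)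
    have hlt : ∀ s ∈ Set.Icc (0 : ℝ) 1, ∀ t : ℝ, 1 < t → t ≤ p.length + 1 →
        edist (c s) (γ (t - 1)) ≤ ENNReal.ofReal (t - s) := by
      intro s hs t ht ht'
      refine (edist_triangle _ (M.vpt w) _).trans ?_
      have h₁ : edist (c s) (M.vpt w) ≤ ENNReal.ofReal (1 - s) := by
        rw [← hc₁]
        refine (hc s hs 1 (by simp)).trans_eq ?_
        rw [abs_sub_comm, abs_of_nonneg (by linarith [hs.2])]
      have h₂ : edist (M.vpt w) (γ (t - 1)) ≤ ENNReal.ofReal (t - 1) := by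
        rw [← hγ₀]
        refine (hl 0 (by simp) (t - 1) ⟨by linarith, by linarith⟩).trans_eq ?_
        rw [abs_sub_comm, abs_of_nonneg (by linarith), sub_zero]
      refine (add_le_add h₁ h₂).trans_eq ?_
      rw [← ENNReal.ofReal_add (by linarith [hs.2]) (by linarith)]
      congr 1
      ring
    refine ⟨fun t => if t ≤ 1 then c t else γ (t - 1), ?_, ?_⟩
    · rintro (_ | _ | n) hn
      · simp [hc₀]
      · simp [hc₁]
      · rw [SimpleGraph.Walk.length_cons] at hn
        have : ¬(((n + 1 + 1 : ℕ) : ℝ) ≤ 1) := by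
          push_cast
          have : (0 : ℝ) ≤ n := n.cast_nonneg
          linarith
        beta_reduce
        rw [if_neg this, SimpleGraph.Walk.getVert_cons_succ, ← hγ (n + 1) (by omega)]
        congr 1
        push_cast
        ring
    · simp only [SimpleGraph.Walk.length_cons, Nat.cast_add, Nat.cast_one]
      rintro s ⟨hs₀, hs₁⟩ t ⟨ht₀, ht₁⟩
      split_ifs with h₁ h₂ h₂
      · exact hc s ⟨hs₀, h₁⟩ t ⟨ht₀, h₂⟩
      · push Not at h₂
        refine (hlt s ⟨hs₀, h₁⟩ t h₂ ht₁).trans_eq ?_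
        rw [abs_sub_comm, abs_of_nonneg (by linarith)]
      · push Not at h₁
        rw [edist_comm]
        refine (hlt t ⟨ht₀, h₂⟩ s h₁ hs₁).trans_eq ?_
        rw [abs_of_nonneg (by linarith)]
      · refine (hl (s - 1) ⟨by linarith, by linarith⟩ (t - 1) ⟨by linarith, by linarith⟩).trans_eq ?_
        rw [sub_sub_sub_cancel_right]

/-- A shortest walk gives a geodesic of the realization passing through its vertices and staying
at distance at most one from them. -/
theorem exists_isGeodesicFromTo {u v : V} (p : M.adjGraph.Walk u v)
    (hp : (p.length : ℕ∞) = M.vdist u v) :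
    ∃ γ : ℝ → M.Realization, IsGeodesicFromTo γ p.length (M.vpt u) (M.vpt v) ∧
      (∀ w ∈ p.support, M.vpt w ∈ γ '' Set.Icc 0 p.length) ∧
      ∀ q ∈ γ '' Set.Icc 0 (p.length : ℝ), ∃ w ∈ p.support, edist q (M.vpt w) ≤ 1 := by
  obtain ⟨γ, hγ, hl⟩ := exists_path_of_walk p
  have hsrc : γ 0 = M.vpt u := by simpa using hγ 0 (Nat.zero_le _)
  have htgt : γ p.length = M.vpt v := by simpa using hγ p.length le_rfl
  have hL : (0 : ℝ) ≤ p.length := Nat.cast_nonneg _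
  -- The endpoints are at distance exactly `p.length`, and the outer pieces are at most `s` and
  -- `p.length - t` long, so the middle piece cannot be shorter than `t - s`.
  have key : ∀ s t : ℝ, 0 ≤ s → s ≤ t → t ≤ p.length →
      edist (γ s) (γ t) = ENNReal.ofReal |s - t| := by
    intro s t hs hst ht
    refine le_antisymm (hl s ⟨hs, hst.trans ht⟩ t ⟨hs.trans hst, ht⟩) ?_
    have h₁ := hl 0 ⟨le_rfl, hL⟩ s ⟨hs, hst.trans ht⟩
    have h₂ := hl t ⟨hs.trans hst, ht⟩ p.length ⟨hL, le_rfl⟩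
    have h₃ : ENNReal.ofReal p.length ≤ edist (γ 0) (γ s) + edist (γ s) (γ t) +
        edist (γ t) (γ p.length) := by
      refine le_trans (le_of_eq ?_) (edist_triangle4 _ _ _ _)
      rw [hsrc, htgt, edist_vpt, ← hp]
      simp
    have hfin : edist (γ s) (γ t) ≠ ⊤ :=
      ((hl s ⟨hs, hst.trans ht⟩ t ⟨hs.trans hst, ht⟩).trans_lt ENNReal.ofReal_lt_top).ne
    have h₄ := h₃.trans (add_le_add (add_le_add h₁ le_rfl) h₂)
    rw [← ENNReal.ofReal_toReal hfin, ← ENNReal.ofReal_add (abs_nonneg _) ENNReal.toReal_nonneg,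
      ← ENNReal.ofReal_add (by positivity) (abs_nonneg _),
      ENNReal.ofReal_le_ofReal_iff (by positivity), abs_of_nonpos (by linarith),
      abs_of_nonpos (by linarith)] at h₄
    rw [← ENNReal.ofReal_toReal hfin]
    apply ENNReal.ofReal_le_ofReal
    rw [abs_of_nonpos (by linarith)]
    linarith
  refine ⟨γ, ⟨hL, hsrc, htgt, fun s hs t ht => ?_⟩, fun w hw => ?_, ?_⟩
  · rcases le_total s t with h | h
    · exact key s t hs.1 h ht.2
    · rw [edist_comm, abs_sub_comm]
      exact key t s ht.1 h hs.2
  · obtain ⟨n, rfl, hn⟩ := SimpleGraph.Walk.mem_support_iff_exists_getVert.1 hw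
    exact ⟨n, ⟨Nat.cast_nonneg _, by exact_mod_cast hn⟩, hγ n hn⟩
  · rintro _ ⟨t, ht, rfl⟩
    have hfl : ⌊t⌋₊ ≤ p.length := by
      have := (Nat.floor_le ht.1).trans ht.2
      exact_mod_cast this
    refine ⟨p.getVert ⌊t⌋₊, p.getVert_mem_support _, ?_⟩
    rw [← hγ _ hfl]
    refine (hl t ht _ ⟨Nat.cast_nonneg _, by exact_mod_cast hfl⟩).trans ?_
    rw [← ENNReal.ofReal_one]
    apply ENNReal.ofReal_le_ofReal
    rw [abs_of_nonneg (by linarith [Nat.floor_le ht.1])]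
    linarith [Nat.lt_floor_add_one t]

theorem exists_hasThinTriangles (hM : M.adjGraph.Connected)
    (hyp : IsRipsHyperbolic M.Realization) : ∃ D, M.adjGraph.HasThinTriangles D := by
  obtain ⟨δ, hδ⟩ := hyp
  -- The extra one pays for moving from a point of a side to a vertex of it.
  refine ⟨⌈δ⌉₊ + 1, fun x y z u hu => ?_⟩
  have hcast : ∀ {a b : V} (r : M.adjGraph.Walk a b), r.length = M.adjGraph.dist a b →
      (r.length : ℕ∞) = M.vdist a b := fun {a b} r hr => by
    rw [hr, (hM a b).coe_dist_eq_edist, vdist]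
  obtain ⟨p, hp, hup⟩ := SimpleGraph.exists_walk_through_of_isBtw hM hu
  obtain ⟨q, hq⟩ := hM.exists_walk_length_eq_dist y z
  obtain ⟨r, hr⟩ := hM.exists_walk_length_eq_dist z x
  obtain ⟨α, hα, hαs, -⟩ := exists_isGeodesicFromTo p (hcast p hp)
  obtain ⟨β, hβ, -, hβn⟩ := exists_isGeodesicFromTo q (hcast q hq)
  obtain ⟨γ, hγ, -, hγn⟩ := exists_isGeodesicFromTo r (hcast r hr)
  obtain ⟨c, hc, huc⟩ := hδ _ _ _ α β γ _ _ _ hα hβ hγ _ (hαs u hup)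
  obtain ⟨v, hv, hcv⟩ : ∃ v, (M.adjGraph.IsBtw y v z ∨ M.adjGraph.IsBtw z v x) ∧
      edist c (M.vpt v) ≤ 1 := by
    rcases hc with hc | hc
    · obtain ⟨v, hv, hcv⟩ := hβn c hc
      exact ⟨v, Or.inl (q.isBtw_of_mem_support hM hq hv), hcv⟩
    · obtain ⟨v, hv, hcv⟩ := hγn c hc
      exact ⟨v, Or.inr (r.isBtw_of_mem_support hM hr hv), hcv⟩
  refine ⟨v, hv, ?_⟩
  have h := (edist_triangle (M.vpt u) c (M.vpt v)).trans (add_le_add huc hcv)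
  rw [edist_vpt, vdist, ← (hM u v).coe_dist_eq_edist] at h
  have h' : (M.adjGraph.dist u v : ℝ≥0) ≤ δ + 1 := by
    have : ((M.adjGraph.dist u v : ℝ≥0) : ℝ≥0∞) ≤ ((δ + 1 : ℝ≥0) : ℝ≥0∞) := by
      simpa using h
    exact_mod_cast this
  have : (M.adjGraph.dist u v : ℝ≥0) ≤ ((⌈δ⌉₊ + 1 : ℕ) : ℝ≥0) := by
    refine h'.trans ?_
    push_cast
    gcongr
    exact Nat.le_ceil δ
  exact_mod_cast this

end MetricGraph

/-! ## The relative Cayley graph -/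

section HyperbolicallyEmbedded

variable {G : Type*} [Group G] {Λ : Type*} {H : Λ → Subgroup G} {X : Set G}

theorem relCayleyGraph_adj_mul {g x : G} (hx : x ≠ 1) (h : x ∈ X ∪ ⋃ i, (H i : Set G)) :
    (relCayleyGraph H X).adjGraph.Adj g (g * x) := by
  refine ⟨by simpa using hx, Or.inl ?_⟩
  rcases h with h | h
  · exact ⟨(g, .inl ⟨x, h⟩), rfl, rfl⟩
  · obtain ⟨i, hi⟩ := Set.mem_iUnion.1 h
    exact ⟨(g, .inr ⟨i, ⟨x, hi⟩⟩), rfl, rfl⟩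

theorem relCayleyGraph_edist_mul_le_one {g x : G} (h : x ∈ X ∪ ⋃ i, (H i : Set G)) :
    (relCayleyGraph H X).adjGraph.edist g (g * x) ≤ 1 := by
  by_cases hx : x = 1
  · simp [hx]
  · exact (SimpleGraph.edist_eq_one_iff_adj.2 (relCayleyGraph_adj_mul hx h)).le

theorem IsRelGeneratingSet.connected (h : IsRelGeneratingSet H X) :
    (relCayleyGraph H X).adjGraph.Connected := by
  -- The base point `g` is kept arbitrary so that products and inverses pass through the induction.
  have key : ∀ x : G, ∀ g, (relCayleyGraph H X).adjGraph.Reachable g (g * x) := by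
    intro x
    have hx : x ∈ Subgroup.closure (X ∪ ⋃ i, (H i : Set G)) := h.closure_eq_top ▸ Subgroup.mem_top x
    induction hx using Subgroup.closure_induction with
    | mem x hx =>
      exact fun g => SimpleGraph.reachable_of_edist_ne_top
        ((relCayleyGraph_edist_mul_le_one hx).trans_lt (by simp)).ne
    | one => simp
    | mul x y _ _ hx hy => exact fun g => (hx g).trans (mul_assoc g x y ▸ hy (g * x))
    | inv x _ hx => exact fun g => by simpa using (hx (g * x⁻¹)).symm
  have : Nonempty G := ⟨1⟩
  exact ⟨fun g k => by simpa using key (g⁻¹ * k) g⟩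

theorem relCayleyGraph_edist_le_one_of_mem {i : Λ} {h k : G} (hh : h ∈ H i) (hk : k ∈ H i) :
    (relCayleyGraph H X).adjGraph.edist h k ≤ 1 := by
  simpa using relCayleyGraph_edist_mul_le_one (H := H) (X := X) (g := h) (x := h⁻¹ * k)
    (Or.inr (Set.mem_iUnion.2 ⟨i, mul_mem (inv_mem hh) hk⟩))

/-- Every deleted edge has both ends in `H i`. This is the hypothesis `hB` of the projection lemmas
with `S = H i`. -/
theorem deltaGraph_adj_of_not_mem {i : Λ} {g k : G} (h : (relCayleyGraph H X).adjGraph.Adj g k)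
    (hgk : ¬(g ∈ H i ∧ k ∈ H i)) : (deltaGraph H X i).adjGraph.Adj g k := by
  have aux : ∀ e : G × RelAlphabet H X,
      ¬((relCayleyGraph H X).src e ∈ H i ∧ (relCayleyGraph H X).tgt e ∈ H i) →
        ¬IsSubgroupEdge H X i e := by
    rintro ⟨g, a⟩ hn ⟨hg, h, rfl⟩
    exact hn ⟨hg, mul_mem hg h.2⟩
  obtain ⟨hne, ⟨e, rfl, rfl⟩ | ⟨e, rfl, rfl⟩⟩ := h
  · exact ⟨hne, Or.inl ⟨⟨e, aux e hgk⟩, rfl, rfl⟩⟩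
  · exact ⟨hne, Or.inr ⟨⟨e, aux e fun h => hgk h.symm⟩, rfl, rfl⟩⟩

/-- An edge labelled by a letter outside `H i` survives in the graph `Δ i`. -/
theorem deltaGraph_edist_mul_le_one {i : Λ} {g x : G} (h : x ∈ X ∨ ∃ j ≠ i, x ∈ H j) :
    (deltaGraph H X i).adjGraph.edist g (g * x) ≤ 1 := by
  by_cases hx : x = 1
  · simp [hx]
  suffices hadj : (deltaGraph H X i).adjGraph.Adj g (g * x) from
    (SimpleGraph.edist_eq_one_iff_adj.2 hadj).le
  refine ⟨by simpa using hx, Or.inl ?_⟩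
  rcases h with h | ⟨j, hj, h⟩
  · exact ⟨⟨(g, .inl ⟨x, h⟩), by rintro ⟨-, k, hk⟩; cases hk⟩, rfl, rfl⟩
  · refine ⟨⟨(g, .inr ⟨j, ⟨x, h⟩⟩), ?_⟩, rfl, rfl⟩
    rintro ⟨-, k, hk⟩
    rw [Sum.inr.injEq, Sigma.mk.injEq] at hk
    exact hj hk.1

theorem deltaGraph_adj_mul_left {i : Λ} {h : G} (hh : h ∈ H i) {g k : G}
    (hgk : (deltaGraph H X i).adjGraph.Adj g k) :
    (deltaGraph H X i).adjGraph.Adj (h * g) (h * k) := by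
  have aux : ∀ g k : G, (∃ e, (deltaGraph H X i).src e = g ∧ (deltaGraph H X i).tgt e = k) →
      ∃ e, (deltaGraph H X i).src e = h * g ∧ (deltaGraph H X i).tgt e = h * k := by
    rintro _ _ ⟨⟨⟨g, a⟩, hga⟩, rfl, rfl⟩
    refine ⟨⟨(h * g, a), fun ⟨hg, ha⟩ => hga ⟨?_, ha⟩⟩, rfl, ?_⟩
    · simpa using mul_mem (inv_mem hh) hg
    · exact mul_assoc h g _
  exact ⟨fun heq => hgk.1 (mul_left_cancel heq), hgk.2.imp (aux _ _) (aux _ _)⟩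

/-- Left translation by an element of `H i` preserves the set of deleted edges, so it acts on `Δ i`.
-/
theorem subgroupDist_mul_left_le {i : Λ} (h k l : H i) :
    subgroupDist H X i (h * k) (h * l) ≤ subgroupDist H X i k l := by
  unfold subgroupDist MetricGraph.vdist
  by_cases ht : (deltaGraph H X i).adjGraph.edist (k : G) l = ⊤
  · exact ht ▸ le_top
  obtain ⟨p, hp⟩ := SimpleGraph.exists_walk_of_edist_ne_top ht
  let f : (deltaGraph H X i).adjGraph →g (deltaGraph H X i).adjGraph :=
    ⟨fun g => (h : G) * g, deltaGraph_adj_mul_left h.2⟩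
  rw [← hp, ← SimpleGraph.Walk.length_map f p]
  exact SimpleGraph.edist_le _

/-- In a hyperbolically embedded subgroup, the values of any left invariant metric on pairs that
are `n`-close for the relative metric are bounded. -/
theorem IsHypEmbedded.exists_dist_le (hH : IsHypEmbedded H X) {i : Λ}
    (d : IntLeftInvMetric (H i)) (n : ℕ) :
    ∃ M : ℕ, ∀ h k : H i, subgroupDist H X i h k ≤ n → d.d h k ≤ M := by
  -- A single finite ball about `1` suffices, since both metrics allow translating `h` to `1`.
  obtain ⟨M, hM⟩ := ((hH.proper i 1 n).image (d.d 1)).bddAbove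
  refine ⟨M, fun h k hhk => ?_⟩
  have := hM ⟨h⁻¹ * k, ?_, rfl⟩
  · rwa [← d.d_mul_left h, mul_one, mul_inv_cancel_left] at this
  · simpa using (subgroupDist_mul_left_le h⁻¹ h k).trans hhk

/-! ## Induced metrics -/

/-- If `h ≠ 1` also lies in `X`, its weight is one, which cannot exceed a nonzero integer distance.
-/
theorem inducedWeight_le {C : ∀ i, IntLeftInvMetric (H i)} {i : Λ} (h : H i) :
    inducedWeight X C h ≤ (C i).d 1 h := by
  unfold inducedWeight
  split_ifs with h₁ h₂
  · exact zero_le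
  · have : (C i).d 1 h ≠ 0 := fun h₀ => h₁ (by rw [← ((C i).d_eq_zero_iff _ _).1 h₀]; rfl)
    exact_mod_cast Nat.one_le_iff_ne_zero.2 this
  · exact iInf₂_le i h.2

theorem one_le_inducedWeight {C : ∀ i, IntLeftInvMetric (H i)} {x : G} (hx : x ≠ 1) :
    1 ≤ inducedWeight X C x := by
  unfold inducedWeight
  rw [if_neg hx]
  split_ifs
  · exact le_rfl
  · refine le_iInf₂ fun i hi => ?_
    have : (C i).d 1 ⟨x, hi⟩ ≠ 0 := fun h₀ =>
      hx (congrArg Subtype.val (((C i).d_eq_zero_iff _ _).1 h₀)).symm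
    exact_mod_cast Nat.one_le_iff_ne_zero.2 this

theorem mem_of_inducedWeight_ne_top {C : ∀ i, IntLeftInvMetric (H i)} {x : G} (hx : x ≠ 1)
    (h : inducedWeight X C x ≠ ⊤) : x ∈ X ∪ ⋃ i, (H i : Set G) := by
  unfold inducedWeight at h
  rw [if_neg hx] at h
  split_ifs at h with hX
  · exact Or.inl hX
  · by_contra hn
    refine h (iInf₂_eq_top.2 fun i hi => (hn (Or.inr (Set.mem_iUnion.2 ⟨i, hi⟩))).elim)

theorem inducedWeight_eq {C : ∀ i, IntLeftInvMetric (H i)} {i : Λ} {x : G} (hx : x ≠ 1)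
    (hX : x ∉ X) (hi : x ∈ H i) (hj : ∀ j ≠ i, x ∉ H j) :
    inducedWeight X C x = (C i).d 1 ⟨x, hi⟩ := by
  unfold inducedWeight
  rw [if_neg hx, if_neg hX]
  refine le_antisymm (iInf₂_le i hi) (le_iInf₂ fun j hxj => ?_)
  obtain rfl : j = i := by_contra fun hne => hj j hne hxj
  exact le_rfl

/-- There is a retraction of `G` onto `H i` that expands weights by a bounded factor. -/
theorem IsHypEmbedded.exists_retraction (hH : IsHypEmbedded H X)
    (C : ∀ i, IntLeftInvMetric (H i)) (i : Λ) :
    ∃ (π : G → H i) (M : ℕ), 1 ≤ M ∧ (∀ h : H i, π h = h) ∧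
      ∀ g x : G, ((C i).d (π g) (π (g * x)) : ℕ∞) ≤ M * inducedWeight X C x := by
  have hA := hH.gen.connected
  obtain ⟨D, hD⟩ := MetricGraph.exists_hasThinTriangles hA hH.hyperbolic
  obtain ⟨M, hM⟩ := hH.exists_dist_le (C i) (8 * D + 8)
  have hS : (H i : Set G).Nonempty := ⟨1, one_mem _⟩
  choose ρ hρ using SimpleGraph.exists_isNearest (A := (relCayleyGraph H X).adjGraph) hS
  let π : G → H i := fun g => ⟨ρ g, (hρ g).1⟩
  have hπ : ∀ h : H i, π h = h := fun h => Subtype.ext ((hρ h).eq_of_mem hA h.2)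
  have dist_le : ∀ {a b : G}, (relCayleyGraph H X).adjGraph.edist a b ≤ 1 →
      (relCayleyGraph H X).adjGraph.dist a b ≤ 1 := fun {a b} h => by
    rw [← (hA a b).coe_dist_eq_edist] at h
    exact_mod_cast h
  -- The factor must be at least one: letters of `H i` have displacement equal to their weight, and
  -- a factor `0` would kill infinite weights.
  refine ⟨π, max M 1, le_max_right _ _, hπ, fun g x => ?_⟩
  by_cases hx : x = 1
  · have : (C i).d (π g) (π g) = 0 := ((C i).d_eq_zero_iff _ _).2 rfl
    simp [hx, this]
  have hw := one_le_inducedWeight (X := X) (C := C) hx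
  by_cases ht : inducedWeight X C x = ⊤
  · rw [ht, ENat.mul_top (by simp)]
    exact le_top
  have hxm := mem_of_inducedWeight_ne_top hx ht
  by_cases hB : (deltaGraph H X i).adjGraph.edist g (g * x) ≤ 1
  · have h₁ : (C i).d (π g) (π (g * x)) ≤ M := hM _ _ <|
      (hρ g).edist_le_of_edist_le_one hA hD
        (fun _ _ hadj hn => deltaGraph_adj_of_not_mem hadj hn)
        (fun _ hs _ ht => dist_le (relCayleyGraph_edist_le_one_of_mem hs ht)) (hρ (g * x))
        (dist_le (relCayleyGraph_edist_mul_le_one hxm)) hB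
    calc ((C i).d (π g) (π (g * x)) : ℕ∞) ≤ (max M 1 : ℕ) * 1 := by
          rw [mul_one]
          exact_mod_cast h₁.trans (le_max_left _ _)
      _ ≤ _ := by gcongr
  -- No edge of `Δ i` joins `g` to `g * x`, so `x` is a letter of `H i` only and the infimum
  -- defining its weight has a single term.
  · have hn : ¬(x ∈ X ∨ ∃ j ≠ i, x ∈ H j) := fun h => hB (deltaGraph_edist_mul_le_one h)
    push Not at hn
    have hg : g ∈ H i ∧ g * x ∈ H i := by
      by_contra hg
      exact hB (SimpleGraph.edist_eq_one_iff_adj.2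
        (deltaGraph_adj_of_not_mem (relCayleyGraph_adj_mul hx hxm) hg)).le
    have hxi : x ∈ H i := by simpa using mul_mem (inv_mem hg.1) hg.2
    have h₁ : π g = ⟨g, hg.1⟩ := hπ ⟨g, hg.1⟩
    have h₂ : π (g * x) = ⟨g, hg.1⟩ * ⟨x, hxi⟩ := hπ (⟨g, hg.1⟩ * ⟨x, hxi⟩)
    have h₃ := (C i).d_mul_left ⟨g, hg.1⟩ 1 ⟨x, hxi⟩
    rw [mul_one] at h₃
    rw [h₁, h₂, h₃, inducedWeight_eq hx hn.1 hxi hn.2]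
    exact_mod_cast Nat.le_mul_of_pos_left _ (by positivity)

theorem IsHypEmbedded.isIncompressibleWrt (hH : IsHypEmbedded H X) : IsIncompressibleWrt H X := by
  refine ⟨hH.gen, fun C i => ?_⟩
  obtain ⟨π, M, hM, hπ, hstep⟩ := hH.exists_retraction C i
  -- The one-letter bound is summed along the path that spells `l` from `g`; its intermediate
  -- vertices may leave `H i`.
  have hlist : ∀ (l : List G) (g : G), ((C i).d (π g) (π (g * l.prod)) : ℕ∞) ≤
      M * (l.map (inducedWeight X C)).sum := by
    intro l
    induction l with
    | nil =>
      intro g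
      have : (C i).d (π g) (π g) = 0 := ((C i).d_eq_zero_iff _ _).2 rfl
      simp [this]
    | cons x l ih =>
      intro g
      have h := ih (g * x)
      rw [mul_assoc] at h
      rw [List.prod_cons, List.map_cons, List.sum_cons, mul_add]
      refine le_trans ?_ (add_le_add (hstep g x) h)
      exact_mod_cast (C i).d_triangle _ _ _
  have hlow : ∀ h k : H i, ((C i).d h k : ℕ∞) ≤ M * inducedDist X C h k := by
    intro h k
    unfold inducedDist weightDist
    rw [ENat.mul_iInf]
    refine le_iInf fun l => ?_
    by_cases hl : l.prod = (h : G)⁻¹ * k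
    · rw [iInf_pos hl]
      have := hlist l h
      rwa [hl, mul_inv_cancel_left, hπ, hπ] at this
    · rw [iInf_neg hl, ENat.mul_top (by exact_mod_cast (by omega : M ≠ 0))]
      exact le_top
  have hupp : ∀ h k : H i, inducedDist X C h k ≤ (C i).d h k := by
    intro h k
    refine (iInf₂_le [((h⁻¹ * k : H i) : G)] (by simp)).trans ?_
    rw [List.map_singleton, List.sum_singleton]
    refine (inducedWeight_le _).trans_eq ?_
    rw [← (C i).d_mul_left h, mul_one, mul_inv_cancel_left]
  -- Both inequalities hold without the additive constant.
  refine ⟨M, by exact_mod_cast hM, fun h k => ⟨?_, ?_⟩⟩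
  · refine le_trans (ENNReal.div_le_of_le_mul' ?_) le_self_add
    have := ENat.toENNReal_le.2 (hlow h k)
    simpa using this
  · refine le_trans ?_ le_self_add
    refine (ENat.toENNReal_le.2 (hupp h k)).trans (le_mul_of_one_le_left zero_le ?_)
    exact_mod_cast hM

end HyperbolicallyEmbedded

end

theorem mainTheorem8 {G : Type u} [Group G] :
    (∀ (Λ : Type v) (H : Λ → Subgroup G) (X : Set G),
      IsHypEmbedded H X → IsIncompressibleWrt H X) ∧
    (∀ (n : ℕ) (H : Fin n → Subgroup G),
      Group.FG G → IsRelativelyHyperbolic H → IsIncompressible H) :=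
  ⟨fun _ _ _ hH => hH.isIncompressibleWrt,
    fun _ _ _ ⟨Y, hY, hH⟩ => ⟨Y, hY, hH.isIncompressibleWrt⟩⟩
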